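/- \textbf{Model.} A job $j$ has a value $v_j>0$, a demand $D_j>0$, an arrival time $a_j\ge 0$ and a deadline $d_j>a_j$. There are $C$ identical servers; at every time each server processes at most one job and each job is processed by at most one server; preemption and migration are allowed, and a job is not processed before it arrives. A job is completed if it is processed for a total time of (at least) $D_j$ during $[a_j,d_j]$. An instance $\tau$ is a finite set of jobs; its slackness is $s(\tau)=\min_{j\in\tau}\frac{d_j-a_j}{D_j}$. A (deterministic) online scheduler $\mathcal A$ chooses, for every instance, a schedule and, for each job $j$, either a time $t_j\ge a_j$ at which it commits to (admits) $j$, or to reject $j$; its actions at time $t$ depend only on the jobs that have arrived by time $t$. The scheduler is \emph{committed} if for some $\beta\ge 0$ it is $\beta$-responsive: for every job $j$, by time $d_j-\beta D_j$ it either rejects $j$ or commits to $j$, and every job it commits to is completed by its deadline. It satisfies \emph{no early processing} if no job is processed before the scheduler has committed to it (in particular, rejected jobs are never processed). With $v(\mathcal A(\tau))$ the total value of the jobs that $\mathcal A$ completes on $\tau$ and $v(OPT(\tau))$ the largest total value of completed jobs over all offline schedules of $\tau$ on $C$ servers, let $$\mathrm{cr}_{\mathcal A}(s)=\sup_{\tau:\,s(\tau)=s}\frac{v(OPT(\tau))}{v(\mathcal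 A(\tau))}\in[0,\infty],$$ where the quotient is $\infty$ if $v(\mathcal A(\tau))=0<v(OPT(\tau))$ and $0$ if both values are $0$. \textbf{Theorem.} Let $C\in\{1,2,3\}$ and $0<s<4/C$. Every committed online scheduler $\mathcal A$ for $C$ servers with no early processing has unbounded competitive ratio: $\mathrm{cr}_{\mathcal A}(s)=\infty$. In particular, on a single server, every online algorithm that commits to jobs on admission (so that jobs are processed only after they are admitted, and every admitted job is completed by its deadline) has $\mathrm{cr}_{\mathcal A}(s)=\infty$ for all $0<s<4$. -/

import Mathlib

open scoped ENNReal

namespace Sched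

/-- A job request: its type (value, demand, arrival time, deadline), together with a label, so that
an instance may contain several jobs of the same type. -/
structure Job where
  label : ℕ
  value : ℝ
  demand : ℝ
  arrival : ℝ
  deadline : ℝ
  value_pos : 0 < value
  demand_pos : 0 < demand
  arrival_nonneg : 0 ≤ arrival
  arrival_lt_deadline : arrival < deadline

/-- An instance of the scheduling problem: a finite set of job requests. -/
abbrev Instance := Finset Job

/-- The jobs of `τ` that have arrived by time `t` (inclusively). -/
def revealed (τ : Instance) (t : ℝ) : Set Job := {j | j ∈ τ ∧ j.arrival ≤ t}

/-- The slackness of `τ` is `s`, the least of the ratios `(d_j - a_j) / D_j` over the jobs of `τ`.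
(The empty instance has no slackness.) -/
def HasSlackness (τ : Instance) (s : ℝ) : Prop :=
  IsLeast {r : ℝ | ∃ j ∈ τ, r = (j.deadline - j.arrival) / j.demand} s

/-- A preemptive (and migratory) schedule of the jobs of `τ` on `C` identical servers:
`run i t` is the job that server `i` processes at time `t`, or `none` if it is idle. -/
structure Schedule (C : ℕ) (τ : Instance) where
  run : Fin C → ℝ → Option Job
  mem_of_run : ∀ i t j, run i t = some j → j ∈ τ
  arrival_le_of_run : ∀ i t j, run i t = some j → j.arrival ≤ t
  one_server : ∀ i i' t j, run i t = some j → run i' t = some j → i = i'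
  measurable_run : ∀ i j, MeasurableSet {t : ℝ | run i t = some j}

namespace Schedule

variable {C : ℕ} {τ : Instance}

/-- The total time that the servers devote to job `j` during its window `[a_j, d_j]`. -/
noncomputable def processing (σ : Schedule C τ) (j : Job) : ℝ≥0∞ :=
  ∑ i : Fin C, MeasureTheory.volume {t : ℝ | t ∈ Set.Icc j.arrival j.deadline ∧ σ.run i t = some j}

/-- Job `j` is completed by its deadline. -/
def Completes (σ : Schedule C τ) (j : Job) : Prop :=
  ENNReal.ofReal j.demand ≤ σ.processing j

open Classical in
/-- The aggregate value of the jobs that are completed by their deadlines. -/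
noncomputable def totalValue (σ : Schedule C τ) : ℝ≥0∞ :=
  ∑ j ∈ τ.filter (fun j => σ.Completes j), ENNReal.ofReal j.value

end Schedule

/-- The value of an optimal offline schedule of `τ` on `C` servers. -/
noncomputable def optValue (C : ℕ) (τ : Instance) : ℝ≥0∞ :=
  ⨆ σ : Schedule C τ, σ.totalValue

/-- A deterministic online scheduler for `C` servers. On every instance it produces a schedule and
decides which jobs it commits to, and when: `commit τ j = some t` means that the scheduler commits
to (admits) job `j` at time `t`, and `commit τ j = none` that it never does, that is, it rejects
`j`. What the scheduler does at time `t` depends only on the jobs that have arrived by time `t`. -/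
structure OnlineScheduler (C : ℕ) where
  schedule : (τ : Instance) → Schedule C τ
  commit : Instance → Job → Option ℝ
  mem_of_commit : ∀ τ j t, commit τ j = some t → j ∈ τ
  arrival_le_of_commit : ∀ τ j t, commit τ j = some t → j.arrival ≤ t
  run_online : ∀ τ τ' t, revealed τ t = revealed τ' t →
    ∀ i, (schedule τ).run i t = (schedule τ').run i t
  commit_online : ∀ τ τ' t, revealed τ t = revealed τ' t →
    ∀ j, (commit τ j = some t ↔ commit τ' j = some t)

namespace OnlineScheduler

variable {C : ℕ}

/-- `β`-responsiveness: for every job `j`, by time `d_j - β D_j` the scheduler either rejects `j`, or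
commits to `j`, and every job that it commits to is completed by its deadline. -/
def IsResponsive (A : OnlineScheduler C) (β : ℝ) : Prop :=
  ∀ τ j t, A.commit τ j = some t →
    t ≤ j.deadline - β * j.demand ∧ (A.schedule τ).Completes j

/-- A committed scheduler: one that is `β`-responsive for some `β ≥ 0`. -/
def IsCommitted (A : OnlineScheduler C) : Prop := ∃ β : ℝ, 0 ≤ β ∧ A.IsResponsive β

/-- No early processing: a job is processed only from the time on at which the scheduler has
committed to it. -/
def NoEarlyProcessing (A : OnlineScheduler C) : Prop :=
  ∀ τ i t j, (A.schedule τ).run i t = some j → ∃ u, A.commit τ j = some u ∧ u ≤ t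

/-- The competitive ratio of `A` on inputs of slackness `s`: the supremum of
`v(OPT(τ)) / v(A(τ))` over the instances `τ` of slackness `s`. In `ℝ≥0∞`, the quotient is `∞` if
`v(A(τ)) = 0 < v(OPT(τ))`, and `0` if both values are `0`. -/
noncomputable def competitiveRatio (A : OnlineScheduler C) (s : ℝ) : ℝ≥0∞ :=
  ⨆ (τ : Instance) (_ : HasSlackness τ s), optValue C τ / (A.schedule τ).totalValue

end OnlineScheduler

end Sched

namespace Sched

/-! ### Real sequences with small tail sums -/

/-- A positive sequence whose tail sums are at most `c < 4` times the second term of the tail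
cannot be long. -/
theorem exists_length_forall_not_sum_Ico_le {c : ℝ} (hc0 : 0 < c) (hc : c < 4) :
    ∃ n : ℕ, ∀ r : ℕ → ℝ, (∀ i, i < n → 0 < r i) →
      ¬ ∀ m, m + 1 < n → ∑ i ∈ Finset.Ico m n, r i ≤ c * r (m + 1) := by
  -- Any `δ > 0` with `c * (1 + δ) ^ 2 ≤ 4` would do.
  obtain ⟨δ, hδ⟩ : ∃ δ : ℝ, δ = (4 - c) / 16 := ⟨_, rfl⟩
  have hδ0 : 0 < δ := by rw [hδ]; linarith
  have hcδ : c * (1 + δ) ^ 2 ≤ 4 := by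
    have : c = 4 - 16 * δ := by rw [hδ]; ring
    rw [this]
    nlinarith [pow_pos hδ0 2, pow_pos hδ0 3]
  obtain ⟨M, hM⟩ := exists_nat_gt (1 / δ)
  have hM' : 1 < M * δ := by rwa [div_lt_iff₀ hδ0] at hM
  refine ⟨M + 2, fun r hr h => ?_⟩
  set n := M + 2 with hn
  let S : ℕ → ℝ := fun m => ∑ i ∈ Finset.Ico m n, r i
  have hS : ∀ m, m < n → S m = r m + S (m + 1) := fun m hm =>
    Finset.sum_eq_sum_Ico_succ_bot hm r
  have hpos : ∀ m, m < n → 0 < S m := fun m hm =>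
    Finset.sum_pos (fun i hi => hr i (Finset.mem_Ico.1 hi).2) (Finset.nonempty_Ico.2 hm)
  -- The ratio of consecutive tail sums drops by at least `δ` at each step, so it would become
  -- negative.
  have key : ∀ m, m < n → S (m + 1) ≤ (1 - m * δ) * S m := by
    intro m
    induction m with
    | zero =>
      intro h0
      have := hS 0 h0
      have := hr 0 h0
      simp only [Nat.cast_zero, zero_mul, sub_zero, one_mul]
      linarith
    | succ m ih =>
      intro hm
      have h1 := ih (by omega)
      have h2 : S m ≤ c * r (m + 1) := h m hm
      have h3 := hS (m + 1) hm
      have p0 := hpos m (by omega)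
      have p1 := hpos (m + 1) hm
      obtain ⟨q, hq⟩ : ∃ q : ℝ, q = 1 - m * δ := ⟨_, rfl⟩
      rw [← hq] at h1
      have hq0 : 0 < q := by
        by_contra hneg
        have := mul_nonpos_of_nonpos_of_nonneg (not_lt.1 hneg) p0.le
        linarith
      -- From a ratio at most `q`, the next is at most `1 - 1 / (c * q)`. That this is at most `q -
      -- δ` is this quadratic inequality, whose discriminant is nonpositive by `hcδ`.
      have hquad : 0 ≤ c * q ^ 2 - (1 + δ) * c * q + 1 := by
        have h5 : 0 ≤ c * (q - (1 + δ) / 2) ^ 2 := by positivity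
        nlinarith
      have hcast : (1 : ℝ) - ((m + 1 : ℕ) : ℝ) * δ = q - δ := by rw [hq]; push_cast; ring
      rw [hcast]
      have h6 : S (m + 1) ≤ c * q * r (m + 1) := by
        calc S (m + 1) ≤ q * S m := h1
          _ ≤ q * (c * r (m + 1)) := by gcongr
          _ = _ := by ring
      have h7 : 0 ≤ (c * q ^ 2 - (1 + δ) * c * q + 1) * S (m + 1) := mul_nonneg hquad p1.le
      have h8 : 0 ≤ (c * q) * ((q - δ) * S (m + 1) - S (m + 1 + 1)) := by
        have : S (m + 1 + 1) = S (m + 1) - r (m + 1) := by linarith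
        rw [this]
        nlinarith
      have := nonneg_of_mul_nonneg_right h8 (by positivity)
      linarith
  have h1 := key M (by omega)
  have p1 := hpos (M + 1) (by omega)
  have p0 := hpos M (by omega)
  nlinarith

/-! ### Server capacity and the offline optimum -/

/-- On each server the processing sets of distinct jobs are disjoint subsets of `[U, d]`. -/
theorem Schedule.sum_demand_le {C : ℕ} {τ : Instance} (σ : Schedule C τ) (I : Finset ℕ)
    (j : ℕ → Job) (hinj : Set.InjOn j I) {U d : ℝ}
    (hcomp : ∀ k ∈ I, σ.Completes (j k)) (hd : ∀ k ∈ I, (j k).deadline ≤ d)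
    (hU : ∀ k ∈ I, ∀ i t, σ.run i t = some (j k) → U ≤ t) :
    ∑ k ∈ I, ENNReal.ofReal (j k).demand ≤ C * ENNReal.ofReal (d - U) := by
  let E : Fin C → ℕ → Set ℝ := fun i k =>
    {t : ℝ | t ∈ Set.Icc (j k).arrival (j k).deadline ∧ σ.run i t = some (j k)}
  have hE : ∀ i k, MeasurableSet (E i k) := fun i k =>
    measurableSet_Icc.inter (σ.measurable_run i (j k))
  calc ∑ k ∈ I, ENNReal.ofReal (j k).demand
      ≤ ∑ k ∈ I, ∑ i : Fin C, MeasureTheory.volume (E i k) := Finset.sum_le_sum hcomp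
    _ = ∑ i : Fin C, ∑ k ∈ I, MeasureTheory.volume (E i k) := Finset.sum_comm
    _ = ∑ i : Fin C, MeasureTheory.volume (⋃ k ∈ I, E i k) := by
        refine Finset.sum_congr rfl fun i _ => ?_
        rw [MeasureTheory.measure_biUnion_finset _ fun k _ => hE i k]
        intro k hk l hl hkl
        refine Set.disjoint_left.2 fun t ht ht' => hkl (hinj hk hl ?_)
        exact Option.some_injective _ (ht.2.symm.trans ht'.2)
    _ ≤ ∑ _i : Fin C, MeasureTheory.volume (Set.Icc U d) := by
        refine Finset.sum_le_sum fun i _ => MeasureTheory.measure_mono ?_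
        refine Set.iUnion₂_subset fun k hk t ht => ⟨hU k hk i t ht.2, ht.1.2.trans (hd k hk)⟩
    _ = C * ENNReal.ofReal (d - U) := by
        simp [Real.volume_Icc]

open Classical in
/-- The schedule that processes only the job `j`, on server `i₀`, throughout its window. -/
noncomputable def Schedule.single {C : ℕ} {τ : Instance} (i₀ : Fin C) (j : Job) (hj : j ∈ τ) :
    Schedule C τ where
  run i t := if i = i₀ ∧ t ∈ Set.Icc j.arrival j.deadline then some j else none
  mem_of_run i t k h := by
    split_ifs at h with h1
    cases h; exact hj
  arrival_le_of_run i t k h := by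
    split_ifs at h with h1
    cases h; exact h1.2.1
  one_server i i' t k h h' := by
    split_ifs at h h' with h1 h2
    exact h1.1.trans h2.1.symm
  measurable_run i k := by
    by_cases h : i = i₀ ∧ j = k
    · convert measurableSet_Icc (a := j.arrival) (b := j.deadline) using 1
      ext t
      simp [h.1, h.2]
    · convert MeasurableSet.empty using 1
      ext t
      simp only [Set.mem_ofPred_eq, Set.mem_empty_iff_false, iff_false]
      intro h1
      split_ifs at h1 with h2
      exact h ⟨h2.1, Option.some_injective _ h1⟩

theorem Schedule.single_completes {C : ℕ} {τ : Instance} (i₀ : Fin C) {j : Job} (hj : j ∈ τ)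
    (h : j.demand ≤ j.deadline - j.arrival) : (Schedule.single i₀ j hj).Completes j := by
  unfold Schedule.Completes Schedule.processing
  refine le_trans ?_ (Finset.single_le_sum (fun _ _ => zero_le) (Finset.mem_univ i₀))
  have : {t : ℝ | t ∈ Set.Icc j.arrival j.deadline ∧
      (Schedule.single i₀ j hj).run i₀ t = some j} = Set.Icc j.arrival j.deadline := by
    ext t
    simp only [Schedule.single, Set.mem_ofPred_eq, true_and]
    exact ⟨fun h => h.1, fun h => ⟨h, if_pos h⟩⟩
  rw [this, Real.volume_Icc]
  exact ENNReal.ofReal_le_ofReal h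

theorem value_le_optValue {C : ℕ} (hC : 1 ≤ C) {τ : Instance} {j : Job} (hj : j ∈ τ)
    (h : j.demand ≤ j.deadline - j.arrival) : ENNReal.ofReal j.value ≤ optValue C τ := by
  classical
  refine le_trans ?_ (le_iSup _ (Schedule.single (⟨0, hC⟩ : Fin C) j hj))
  unfold Schedule.totalValue
  exact Finset.single_le_sum (f := fun j : Job => ENNReal.ofReal j.value) (fun _ _ => zero_le)
    (Finset.mem_filter.2 ⟨hj, Schedule.single_completes _ hj h⟩)

theorem HasSlackness.insert {τ : Instance} {s : ℝ} (h : HasSlackness τ s) {j : Job}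
    (hj : s ≤ (j.deadline - j.arrival) / j.demand) [DecidableEq Job] :
    HasSlackness (insert j τ) s := by
  obtain ⟨⟨k, hk, hs⟩, hl⟩ := h
  refine ⟨⟨k, Finset.mem_insert_of_mem hk, hs⟩, ?_⟩
  rintro r ⟨l, hl', rfl⟩
  rcases Finset.mem_insert.1 hl' with rfl | hl'
  · exact hj
  · exact hl ⟨l, hl', rfl⟩

/-! ### The adversary -/

namespace OnlineScheduler

variable {C : ℕ}

theorem exists_commit_of_completes {A : OnlineScheduler C} (hA : A.NoEarlyProcessing)
    {τ : Instance} {j : Job} (h : (A.schedule τ).Completes j) : ∃ u, A.commit τ j = some u := by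
  by_contra hn
  have hrun : ∀ i t, (A.schedule τ).run i t ≠ some j := fun i t hr =>
    let ⟨u, hu, _⟩ := hA τ i t j hr
    hn ⟨u, hu⟩
  have : (A.schedule τ).processing j = 0 := by
    simp [Schedule.processing, hrun]
  unfold Schedule.Completes at h
  rw [this, nonpos_iff_eq_zero, ENNReal.ofReal_eq_zero] at h
  exact absurd j.demand_pos (not_lt.2 h)

theorem commit_time_lt_deadline {A : OnlineScheduler C} (hA : A.NoEarlyProcessing)
    {τ : Instance} {j : Job} {u : ℝ} (hu : A.commit τ j = some u)
    (h : (A.schedule τ).Completes j) : u < j.deadline := by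
  have := (A.schedule τ).sum_demand_le {0} (fun _ => j) (by simp) (U := u) (d := j.deadline)
    (fun _ _ => h) (fun _ _ => le_rfl) (fun _ _ i t hr => by
      obtain ⟨v, hv, hvt⟩ := hA τ i t j hr
      rw [hu, Option.some_inj] at hv
      exact hv.trans_le hvt)
  by_contra hn
  rw [ENNReal.ofReal_of_nonpos (p := j.deadline - u) (by linarith)] at this
  simp only [Finset.sum_singleton, mul_zero, nonpos_iff_eq_zero, ENNReal.ofReal_eq_zero] at this
  exact absurd j.demand_pos (not_lt.2 this)

open Classical in
/-- If the competitive ratio is finite, then a job of any given window and small enough demand, of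
sufficiently large value, has to be completed when it is added to an instance. -/
theorem exists_job_completes (A : OnlineScheduler C) (hC : 1 ≤ C) {s : ℝ}
    (hcr : A.competitiveRatio s ≠ ⊤) {τ : Instance} (hτ : HasSlackness τ s) {a d D : ℝ}
    (ha : 0 ≤ a) (had : a < d) (hD : 0 < D) (hD1 : D ≤ d - a) (hDs : s ≤ (d - a) / D) :
    ∃ j : Job, j.arrival = a ∧ j.deadline = d ∧ j.demand = D ∧
      HasSlackness (insert j τ) s ∧ (A.schedule (insert j τ)).Completes j := by
  obtain ⟨V, hV⟩ : ∃ V : ℝ, V = ∑ k ∈ τ, k.value := ⟨_, rfl⟩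
  have hV0 : 0 < V := by
    obtain ⟨⟨k, hk, _⟩, _⟩ := hτ
    rw [hV]
    exact Finset.sum_pos (fun k _ => k.value_pos) ⟨k, hk⟩
  obtain ⟨R, hR⟩ : ∃ R : ℝ, R = (A.competitiveRatio s).toReal := ⟨_, rfl⟩
  have hR0 : 0 ≤ R := hR ▸ ENNReal.toReal_nonneg
  have hv : 0 < (R + 1) * V := by positivity
  -- The other jobs are worth `V` in total, so missing this one would force a ratio of at least `R +
  -- 1`.
  let j : Job := ⟨0, (R + 1) * V, D, a, d, hv, hD, ha, had⟩
  have hsl : HasSlackness (insert j τ) s := hτ.insert hDs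
  refine ⟨j, rfl, rfl, rfl, hsl, ?_⟩
  by_contra hn
  have htot : (A.schedule (insert j τ)).totalValue ≤ ENNReal.ofReal V := by
    rw [hV, ENNReal.ofReal_sum_of_nonneg fun k _ => k.value_pos.le]
    refine Finset.sum_le_sum_of_subset fun k hk => ?_
    obtain ⟨hk, hk'⟩ := Finset.mem_filter.1 hk
    rcases Finset.mem_insert.1 hk with rfl | hk
    · exact absurd hk' hn
    · exact hk
  have hopt : ENNReal.ofReal ((R + 1) * V) ≤ optValue C (insert j τ) :=
    value_le_optValue hC (j := j) (Finset.mem_insert_self _ _) hD1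
  have h1 : ENNReal.ofReal (R + 1) ≤ A.competitiveRatio s := by
    calc ENNReal.ofReal (R + 1) = ENNReal.ofReal ((R + 1) * V / V) := by
          rw [mul_div_cancel_right₀ _ hV0.ne']
      _ = ENNReal.ofReal ((R + 1) * V) / ENNReal.ofReal V := ENNReal.ofReal_div_of_pos hV0
      _ ≤ optValue C (insert j τ) / (A.schedule (insert j τ)).totalValue :=
          ENNReal.div_le_div hopt htot
      _ ≤ A.competitiveRatio s :=
          le_iSup₂ (f := fun (τ : Instance) (_ : HasSlackness τ s) =>
            optValue C τ / (A.schedule τ).totalValue) (insert j τ) hsl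
  rw [ENNReal.ofReal_le_iff_le_toReal hcr, ← hR] at h1
  linarith

/-- A chain of `n` committed jobs with deadline `1` and slackness `s'`, in which each job arrives
shortly after the commitment `u i` to its predecessor; `a n` is the next arrival time. -/
structure CommittedChain (A : OnlineScheduler C) (s s' η : ℝ) (n : ℕ) (τ : Instance)
    (j : ℕ → Job) (u a : ℕ → ℝ) : Prop where
  hasSlackness : HasSlackness τ s
  nonneg : ∀ i ≤ n, 0 ≤ a i
  lt_one : ∀ i ≤ n, a i < 1
  arrival_eq : ∀ i < n, (j i).arrival = a i
  deadline_eq : ∀ i < n, (j i).deadline = 1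
  demand_eq : ∀ i < n, (j i).demand = (1 - a i) / s'
  commit_eq : ∀ i < n, A.commit τ (j i) = some (u i)
  lt_arrival : ∀ i i', i < i' → i' ≤ n → u i < a i'
  gap : ∀ i < n, 1 - u i ≤ (1 + η) * (1 - a (i + 1))

/-- Each extension adds a job that must be admitted; the next arrival time is then put just after
that commitment. -/
theorem exists_committedChain (A : OnlineScheduler C) (hC : 1 ≤ C)
    (hE : A.NoEarlyProcessing) {s s' η : ℝ} (hs : 0 < s) (hss' : s ≤ s') (hs' : 1 ≤ s')
    (hη : 0 < η) (hcr : A.competitiveRatio s ≠ ⊤) (n : ℕ) :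
    ∃ τ j u a, A.CommittedChain s s' η n τ j u a := by
  classical
  induction n with
  | zero =>
    -- This job lies outside the chain and only pins the slackness at exactly `s`; for `s < 1` it
    -- cannot even be completed.
    let k : Job := ⟨0, 1, 1, 0, s, one_pos, one_pos, le_rfl, hs⟩
    refine ⟨{k}, fun _ => k, fun _ => 0, fun _ => 0, ?_, fun _ _ => le_rfl,
      fun _ _ => one_pos, ?_, ?_, ?_, ?_, ?_, ?_⟩
    · refine ⟨⟨k, Finset.mem_singleton_self _, by simp [k]⟩, ?_⟩
      rintro r ⟨l, hl, rfl⟩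
      rw [Finset.mem_singleton.1 hl]
      simp [k]
    all_goals intros; omega
  | succ n ih =>
    obtain ⟨τ, j, u, a, h⟩ := ih
    have ha0 := h.nonneg n le_rfl
    have ha1 := h.lt_one n le_rfl
    have hs0 : 0 < s' := by linarith
    obtain ⟨k, hka, hkd, hkD, hsl, hk⟩ := A.exists_job_completes hC hcr h.hasSlackness
      (a := a n) (d := 1) (D := (1 - a n) / s') ha0 ha1 (div_pos (by linarith) hs0)
      (div_le_self (by linarith) hs') (by
        rwa [div_div_cancel₀ (by linarith : (1 - a n) ≠ 0)])
    obtain ⟨v, hv⟩ := exists_commit_of_completes hE hk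
    have hv1 : v < 1 := hkd ▸ commit_time_lt_deadline hE hv hk
    have hav : a n ≤ v := hka ▸ A.arrival_le_of_commit _ _ _ hv
    -- The solution of `1 - v = (1 + η) * (1 - b)`, which lies strictly between `v` and `1`.
    obtain ⟨b, hb⟩ : ∃ b : ℝ, b = 1 - (1 - v) / (1 + η) := ⟨_, rfl⟩
    have hvb : v < b := by
      have : (1 - v) / (1 + η) < 1 - v := div_lt_self (by linarith) (by linarith)
      linarith
    have hb1 : b < 1 := by
      have : 0 < (1 - v) / (1 + η) := div_pos (by linarith) (by linarith)
      linarith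
    have hbgap : 1 - v ≤ (1 + η) * (1 - b) := by
      rw [hb, sub_sub_cancel, mul_div_cancel₀ _ (by linarith : (1 + η) ≠ 0)]
    have hua : ∀ i < n, u i < a n := fun i hi => h.lt_arrival i n hi le_rfl
    refine ⟨insert k τ, Function.update j n k, Function.update u n v,
      Function.update a (n + 1) b, hsl, ?_, ?_, ?_, ?_, ?_, ?_, ?_, ?_⟩
    · intro i hi
      rcases Nat.le_succ_iff.1 hi with hi | rfl
      · rw [Function.update_of_ne (by omega)]; exact h.nonneg i hi
      · rw [Function.update_self]; linarith
    · intro i hi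
      rcases Nat.le_succ_iff.1 hi with hi | rfl
      · rw [Function.update_of_ne (by omega)]; exact h.lt_one i hi
      · rwa [Function.update_self]
    · intro i hi
      rw [Function.update_of_ne (by omega : i ≠ n + 1)]
      rcases Nat.lt_succ_iff_lt_or_eq.1 hi with hi | rfl
      · rw [Function.update_of_ne hi.ne]; exact h.arrival_eq i hi
      · rwa [Function.update_self]
    · intro i hi
      rcases Nat.lt_succ_iff_lt_or_eq.1 hi with hi | rfl
      · rw [Function.update_of_ne hi.ne]; exact h.deadline_eq i hi
      · rwa [Function.update_self]
    · intro i hi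
      rw [Function.update_of_ne (by omega : i ≠ n + 1)]
      rcases Nat.lt_succ_iff_lt_or_eq.1 hi with hi | rfl
      · rw [Function.update_of_ne hi.ne]; exact h.demand_eq i hi
      · rwa [Function.update_self]
    · intro i hi
      rcases Nat.lt_succ_iff_lt_or_eq.1 hi with hi | rfl
      · rw [Function.update_of_ne hi.ne, Function.update_of_ne hi.ne]
        -- The new job arrives at `a n > u i`, so both instances look the same at time `u i`.
        refine (A.commit_online τ (insert k τ) (u i) ?_ (j i)).1 (h.commit_eq i hi)
        ext l
        have : ¬ k.arrival ≤ u i := by rw [hka]; exact not_le.2 (hua i hi)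
        simp only [revealed, Set.mem_ofPred_eq, Finset.mem_insert]
        constructor
        · exact fun hl => ⟨Or.inr hl.1, hl.2⟩
        · rintro ⟨rfl | hl, hl'⟩
          · exact absurd hl' this
          · exact ⟨hl, hl'⟩
      · simpa only [Function.update_self] using hv
    · intro i i' hii hi'
      rcases Nat.le_succ_iff.1 hi' with hi' | rfl
      · rw [Function.update_of_ne (by omega), Function.update_of_ne (by omega)]
        exact h.lt_arrival i i' hii hi'
      · rw [Function.update_self]
        rcases Nat.lt_succ_iff_lt_or_eq.1 hii with hi | rfl
        · rw [Function.update_of_ne hi.ne]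
          linarith [hua i hi]
        · rwa [Function.update_self]
    · intro i hi
      rcases Nat.lt_succ_iff_lt_or_eq.1 hi with hi | rfl
      · rw [Function.update_of_ne hi.ne, Function.update_of_ne (by omega)]
        exact h.gap i hi
      · rwa [Function.update_self, Function.update_self]

/-- All jobs from index `m` on must fit into `[u m, 1]` on `C` servers, and `gap` replaces `u m` by
`a (m + 1)`. -/
theorem CommittedChain.sum_le {A : OnlineScheduler C} (hA : A.IsCommitted)
    (hE : A.NoEarlyProcessing) {s s' η : ℝ} (hs' : 0 < s') {n : ℕ} {τ : Instance}
    {j : ℕ → Job} {u a : ℕ → ℝ} (h : A.CommittedChain s s' η n τ j u a) {m : ℕ} (hm : m < n) :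
    ∑ i ∈ Finset.Ico m n, (1 - a i) ≤ s' * C * (1 + η) * (1 - a (m + 1)) := by
  obtain ⟨β, -, hβ⟩ := hA
  have hau : ∀ i < n, a i ≤ u i := fun i hi =>
    h.arrival_eq i hi ▸ A.arrival_le_of_commit _ _ _ (h.commit_eq i hi)
  have hlt : ∀ i i', i < i' → i' < n → a i < a i' := fun i i' hi hi' =>
    (hau i (hi.trans hi')).trans_lt (h.lt_arrival i i' hi hi'.le)
  have hu1 : u m < 1 := (h.lt_arrival m n hm le_rfl).trans (h.lt_one n le_rfl)
  have key := (A.schedule τ).sum_demand_le (Finset.Ico m n) j (U := u m) (d := 1) (by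
      intro i hi i' hi' hii
      have hi := (Finset.mem_Ico.1 hi).2
      have hi' := (Finset.mem_Ico.1 hi').2
      have hai : a i = a i' := by rw [← h.arrival_eq i hi, ← h.arrival_eq i' hi', hii]
      rcases lt_trichotomy i i' with hl | hl | hl
      · exact absurd hai (hlt _ _ hl hi').ne
      · exact hl
      · exact absurd hai (hlt _ _ hl hi).ne')
    (fun i hi => (hβ _ _ _ (h.commit_eq i (Finset.mem_Ico.1 hi).2)).2)
    (fun i hi => (h.deadline_eq i (Finset.mem_Ico.1 hi).2).le)
    (fun i hi e t hr => by
      obtain ⟨hmi, hin⟩ := Finset.mem_Ico.1 hi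
      obtain ⟨v, hv, hvt⟩ := hE τ e t (j i) hr
      rw [h.commit_eq i hin, Option.some_inj] at hv
      refine le_trans ?_ (hv.trans_le hvt)
      rcases hmi.eq_or_lt with rfl | hmi
      · exact le_rfl
      · exact (h.lt_arrival m i hmi hin.le).le.trans (hau i hin))
  rw [← ENNReal.ofReal_sum_of_nonneg fun i _ => (j i).demand_pos.le, ← ENNReal.ofReal_natCast,
    ← ENNReal.ofReal_mul (Nat.cast_nonneg C), ENNReal.ofReal_le_ofReal_iff
      (mul_nonneg (Nat.cast_nonneg C) (by linarith)),
    Finset.sum_congr rfl fun i hi => h.demand_eq i (Finset.mem_Ico.1 hi).2,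
    ← Finset.sum_div, div_le_iff₀ hs'] at key
  calc ∑ i ∈ Finset.Ico m n, (1 - a i) ≤ C * (1 - u m) * s' := key
    _ ≤ C * ((1 + η) * (1 - a (m + 1))) * s' := by gcongr; exact h.gap m hm
    _ = _ := by ring

theorem competitiveRatio_eq_top (A : OnlineScheduler C) (hC : 1 ≤ C) (hC4 : C < 4) {s : ℝ}
    (hs : 0 < s) (hs4 : s < 4 / (C : ℝ)) (hA : A.IsCommitted) (hE : A.NoEarlyProcessing) :
    A.competitiveRatio s = ⊤ := by
  by_contra hcr
  have hC0 : (0 : ℝ) < C := by exact_mod_cast hC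
  -- Slackness at least `1` lets each chain job be completed offline; `C < 4` keeps `s' * C < 4`.
  obtain ⟨s', hs'⟩ : ∃ s' : ℝ, s' = max s 1 := ⟨_, rfl⟩
  have hss' : s ≤ s' := hs' ▸ le_max_left s 1
  have h1s' : 1 ≤ s' := hs' ▸ le_max_right s 1
  have hlt : s' * C < 4 := by
    rw [← lt_div_iff₀ hC0, hs']
    refine max_lt hs4 ?_
    rw [lt_div_iff₀ hC0, one_mul]
    exact_mod_cast hC4
  have hpos : 0 < s' * C := mul_pos (by linarith) hC0
  obtain ⟨c, hc, hc4⟩ := exists_between hlt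
  obtain ⟨η, hη⟩ : ∃ η : ℝ, η = c / (s' * C) - 1 := ⟨_, rfl⟩
  have hη0 : 0 < η := by
    rw [hη, sub_pos, one_lt_div hpos]
    exact hc
  have hcη : s' * C * (1 + η) = c := by
    rw [hη]; field_simp; ring
  obtain ⟨n, hn⟩ := exists_length_forall_not_sum_Ico_le (hpos.trans hc) hc4
  obtain ⟨τ, j, u, a, h⟩ := A.exists_committedChain hC hE hs hss' h1s' hη0 hcr n
  refine hn (fun i => 1 - a i) (fun i hi => sub_pos.2 (h.lt_one i hi.le)) fun m hm => ?_
  have := h.sum_le hA hE (by linarith) (m := m) (by omega)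
  rwa [hcη] at this

end OnlineScheduler

end Sched

theorem mainTheorem9 :
    (∀ (C : ℕ) (_ : 1 ≤ C) (_ : C < 4) (s : ℝ) (_ : 0 < s) (_ : s < 4 / (C : ℝ))
      (A : Sched.OnlineScheduler C) (_ : A.IsCommitted) (_ : A.NoEarlyProcessing),
      A.competitiveRatio s = ⊤) ∧
    (∀ (s : ℝ) (_ : 0 < s) (_ : s < 4)
      (A : Sched.OnlineScheduler 1) (_ : A.IsCommitted) (_ : A.NoEarlyProcessing),
      A.competitiveRatio s = ⊤) := by
  refine ⟨fun C hC hC4 s hs hs4 A hA hE => A.competitiveRatio_eq_top hC hC4 hs hs4 hA hE,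
    fun s hs hs4 A hA hE => A.competitiveRatio_eq_top le_rfl (by norm_num) hs ?_ hA hE⟩
  simpa using hs4
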